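/- Let $D$ be an integral domain with quotient field $K$. An overring of $D$ is a ring $T$ with $D\subseteq T\subseteq K$; the Zariski topology on the set $\mathrm{Over}(D)$ of overrings is generated by the sets $\{T : x_1,\dots,x_n\in T\}$, $x_1,\dots,x_n\in K$. A set $\Theta\subseteq \mathrm{Over}(D)$ is a *Jaffard family* of $D$ if - either $\Theta=\{K\}$ or $K\notin\Theta$; - every $T\in\Theta$ is flat over $D$; - $I=\bigcap_{T\in\Theta}IT$ for every ideal $I$ of $D$ (the intersection being taken in $K$); - $TT'=K$ for all distinct $T,T'\in\Theta$; - $\Theta$ is compact in the Zariski topology; - every nonzero $x\in D$ is a nonunit in only finitely many $T\in\Theta$. For a domain $R$, let $\mathrm{Pic}(R)$ be the group of invertible fractional ideals of $R$ modulo the principal ones. For a domain $R$ with quotient field $K$, let $\mathrm{Int}(R)=\{f\in K[X] : f(r)\in R \text{ for all } r\in R\}$, let $\iota_R\colon\mathrm{Pic}(R)\to\mathrm{Pic}(\mathrm{Int}(R))$ be the map $[I]\mapsto[I\,\mathrm{Int}(R)]$, and let $\mathrm{PicPol}(R)=\mathrm{Pic}(\mathrm{Int}(R))/\iota_R(\mathrm{Pic}(R))$.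 If $T$ is a flat overring of $D$, then $\mathrm{Int}(D)\subseteq\mathrm{Int}(T)$, so that there is an extension map $\mathrm{Pic}(\mathrm{Int}(D))\to\mathrm{Pic}(\mathrm{Int}(T))$, $[I]\mapsto[I\,\mathrm{Int}(T)]$. **Theorem.** Let $\Theta$ be a Jaffard family of $D$. Then the map that sends $[I]\in\mathrm{Pic}(\mathrm{Int}(D))$ to the family of the classes of $[I\,\mathrm{Int}(T)]$ in $\mathrm{PicPol}(T)$, $T\in\Theta$, takes values in the direct sum and defines a homomorphism $\pi\colon\mathrm{Pic}(\mathrm{Int}(D))\to\bigoplus_{T\in\Theta}\mathrm{PicPol}(T)$, and the sequence $$0\longrightarrow\mathrm{Pic}(D)\xrightarrow{\ \iota_D\ }\mathrm{Pic}(\mathrm{Int}(D))\xrightarrow{\ \pi\ }\bigoplus_{T\in\Theta}\mathrm{PicPol}(T)\longrightarrow 0$$ is exact. In particular, $\pi$ induces an isomorphism $$\mathrm{PicPol}(D)\simeq\bigoplus_{T\in\Theta}\mathrm{PicPol}(T).$$ -/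

import Mathlib

open scoped DirectSum Polynomial

namespace IntPic

/-! ### Picard groups, written additively -/

/-- The Picard group `Inv(R) / Princ(R)` of a domain: invertible fractional ideals modulo the
principal ones (Mathlib's class group), written additively. -/
abbrev Pic (R : Type*) [CommRing R] [IsDomain R] : Type _ := Additive (ClassGroup R)

/-- The extension map `[I] ↦ [I B]` of Picard groups along an injective homomorphism `f : A → B`
of domains. -/
noncomputable def picMap {A B : Type*} [CommRing A] [IsDomain A] [CommRing B] [IsDomain B]
    (f : A →+* B) (hf : Function.Injective f) : Pic A →+ Pic B :=
  letI : Algebra A B := f.toAlgebra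
  haveI : FaithfulSMul A B := (faithfulSMul_iff_algebraMap_injective A B).mpr hf
  MonoidHom.toAdditive (ClassGroup.extendedHom A B)

/-! ### Integer-valued polynomials -/

section IntegerValued

variable (D K : Type*) [CommRing D] [Field K] [Algebra D K]

/-- The ring `Int(D)` of the polynomials `f ∈ K[X]` such that `f(d) ∈ D` for all `d ∈ D`. -/
def intPoly : Subring K[X] where
  carrier := {f | ∀ d : D, f.eval (algebraMap D K d) ∈ (algebraMap D K).range}
  mul_mem' hf hg d := by
    rw [Polynomial.eval_mul]; exact mul_mem (hf d) (hg d)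
  one_mem' d := by
    rw [Polynomial.eval_one]; exact one_mem _
  add_mem' hf hg d := by
    rw [Polynomial.eval_add]; exact add_mem (hf d) (hg d)
  zero_mem' d := by
    rw [Polynomial.eval_zero]; exact zero_mem _
  neg_mem' hf d := by
    rw [Polynomial.eval_neg]; exact neg_mem (hf d)

/-- The inclusion of `D` into `Int(D)` as constant polynomials. -/
noncomputable def constHom : D →+* intPoly D K :=
  ((Polynomial.C : K →+* K[X]).comp (algebraMap D K)).codRestrict (intPoly D K)
    (fun a d => ⟨a, by simp⟩)

theorem constHom_injective [IsFractionRing D K] : Function.Injective (constHom D K) := by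
  intro a b h
  have h' : (Polynomial.C (algebraMap D K a) : K[X]) = Polynomial.C (algebraMap D K b) :=
    congrArg Subtype.val h
  exact IsFractionRing.injective D K (Polynomial.C_injective h')

variable [IsDomain D] [IsFractionRing D K]

/-- The canonical map `ι_D : Pic(D) → Pic(Int(D))`, `[I] ↦ [I Int(D)]`. -/
noncomputable def picInt : Pic D →+ Pic (intPoly D K) :=
  picMap (constHom D K) (constHom_injective D K)

/-- The int-polynomial Picard group `PicPol(D) = Pic(Int(D)) / ι_D(Pic(D))`. -/
abbrev PicPol : Type _ := Pic (intPoly D K) ⧸ (picInt D K).range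

end IntegerValued

/-! ### Families of overrings -/

section Overrings

variable {D K : Type*} [CommRing D] [IsDomain D] [Field K] [Algebra D K] [IsFractionRing D K]

/-- The overrings of `D` are the subalgebras of the `D`-algebra `K`. The Zariski topology on them is
generated by the sets `B(x₁, …, xₙ)` of the overrings that contain `x₁, …, xₙ ∈ K`. -/
abbrev zariskiTopology (D K : Type*) [CommRing D] [Field K] [Algebra D K] :
    TopologicalSpace (Subalgebra D K) :=
  TopologicalSpace.generateFrom
    (Set.range fun F : Finset K => {T : Subalgebra D K | ∀ x ∈ F, x ∈ T})

/-- Pre-Jaffard families of overrings of `D`. -/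
structure IsPreJaffardFamily (Θ : Set (Subalgebra D K)) : Prop where
  eq_or_notMem : Θ = {⊤} ∨ ⊤ ∉ Θ
  flat : ∀ T ∈ Θ, Module.Flat D T
  /-- Every ideal `I` of `D` is the intersection, inside `K`, of the extensions `I T`, `T ∈ Θ`. -/
  complete : ∀ I : Ideal D, (algebraMap D K '' (I : Set D)) =
    {x : K | ∀ T ∈ Θ, x ∈ Submodule.span T (algebraMap D K '' (I : Set D))}
  /-- `T T' = K` for distinct `T`, `T'` in the family. -/
  independent : ∀ T ∈ Θ, ∀ T' ∈ Θ, T ≠ T' →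
    Subalgebra.toSubmodule T * Subalgebra.toSubmodule T' = ⊤
  compact : @IsCompact _ (zariskiTopology D K) Θ

/-- A Jaffard family is a locally finite pre-Jaffard family. -/
structure IsJaffardFamily (Θ : Set (Subalgebra D K)) : Prop extends IsPreJaffardFamily Θ where
  locallyFinite : ∀ x : D, x ≠ 0 → {T ∈ Θ | ¬ IsUnit (algebraMap D T x)}.Finite

/-- If `t` lies in a flat overring `T`, then `1` is a `T`-combination of elements `d` of `D` with
`d t ∈ D`. -/
theorem exists_denominators (T : Subalgebra D K) [Module.Flat D T] (t : T) :
    Ideal.span {y : T | ∃ d c : D, y = algebraMap D T d ∧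
      algebraMap D K d * t = algebraMap D K c} = ⊤ := by
  obtain ⟨a, b, hb, hab⟩ := IsFractionRing.div_surjective (A := D) (t : K)
  have hb0 : algebraMap D K b ≠ 0 :=
    IsFractionRing.to_map_ne_zero_of_mem_nonZeroDivisors hb
  have hK : algebraMap D K b * t = algebraMap D K a := by
    rw [← hab]; field_simp
  have hrel : ∑ i, (![b, -a] : Fin 2 → D) i • (![t, 1] : Fin 2 → T) i = 0 := by
    apply Subtype.ext
    simp [Fin.sum_univ_two, Algebra.smul_def, hK]
  obtain ⟨k, c, y, hy, hc⟩ := Module.Flat.isTrivialRelation_of_sum_smul_eq_zero hrel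
  rw [Ideal.eq_top_iff_one]
  have h1 : (1 : T) = ∑ j, c 1 j • y j := by simpa using hy 1
  rw [h1]
  refine sum_mem fun j _ => ?_
  rw [Algebra.smul_def]
  refine Ideal.mul_mem_right _ _ (Ideal.subset_span ⟨c 1 j, c 0 j, rfl, ?_⟩)
  have hj : b * c 0 j = a * c 1 j := by
    have := hc j
    simp [Fin.sum_univ_two] at this
    linear_combination this
  apply mul_left_cancel₀ hb0
  rw [← map_mul, hj, map_mul, ← hK]
  ring

/-- If `d t ∈ D` then some power of `d` clears the denominator of `f(t)`, for `f ∈ Int(D)`. -/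
theorem exists_pow_mul_eval (d : D) (t : K)
    (hd : algebraMap D K d * t ∈ (algebraMap D K).range) (n : ℕ) :
    ∀ f ∈ intPoly D K, f.natDegree ≤ n →
      ∃ N : ℕ, algebraMap D K d ^ N * f.eval t ∈ (algebraMap D K).range := by
  induction n with
  | zero =>
    intro f hf hn
    refine ⟨0, ?_⟩
    rw [Polynomial.eq_C_of_natDegree_le_zero hn] at hf ⊢
    simpa using hf 0
  | succ n ih =>
    intro f hf hn
    set s := algebraMap D K d with hs
    set h : K[X] := f.comp (Polynomial.C s * Polynomial.X) with hh
    have hhint : h ∈ intPoly D K := by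
      intro e
      have := hf (d * e)
      simpa [hh, hs] using this
    set g : K[X] := Polynomial.C (s ^ (n + 1)) * f - h with hg
    have hgint : g ∈ intPoly D K := by
      refine sub_mem (mul_mem ?_ hf) hhint
      intro e
      exact ⟨d ^ (n + 1), by simp [hs]⟩
    have hgdeg : g.natDegree ≤ n := by
      rw [Polynomial.natDegree_le_iff_coeff_eq_zero]
      intro m hm
      rw [hg, hh, Polynomial.coeff_sub, Polynomial.coeff_C_mul, Polynomial.comp_C_mul_X_coeff]
      rcases Nat.lt_or_ge (n + 1) m with h1 | h1
      · rw [Polynomial.coeff_eq_zero_of_natDegree_lt (lt_of_le_of_lt hn h1)]; simp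
      · have : m = n + 1 := by omega
        subst this; ring
    obtain ⟨N, hN⟩ := ih g hgint hgdeg
    refine ⟨N + (n + 1), ?_⟩
    have hht : h.eval t ∈ (algebraMap D K).range := by
      obtain ⟨e, he⟩ := hd
      have := hf e
      rw [he] at this
      simpa [hh] using this
    have key : s ^ (N + (n + 1)) * f.eval t = s ^ N * g.eval t + s ^ N * h.eval t := by
      rw [hg]; simp; ring
    rw [key]
    exact add_mem hN (mul_mem (pow_mem (RingHom.mem_range.mpr ⟨d, hs.symm⟩) N) hht)

/-- If `T` is a flat overring of `D` then `Int(D) ⊆ Int(T)`. -/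
theorem intPoly_le (T : Subalgebra D K) (hT : Module.Flat D T) :
    intPoly D K ≤ intPoly T K := by
  intro f hf t
  let J : Ideal T :=
    { carrier := {y : T | ∃ z : T, (z : K) = y * f.eval (t : K)}
      add_mem' := by
        rintro _ _ ⟨z, hz⟩ ⟨w, hw⟩
        exact ⟨z + w, by push_cast; rw [hz, hw]; ring⟩
      zero_mem' := ⟨0, by simp⟩
      smul_mem' := by
        rintro c _ ⟨z, hz⟩
        exact ⟨c * z, by simp [hz, mul_assoc]⟩ }
  have hrad : J.radical = ⊤ := by
    rw [eq_top_iff, ← exists_denominators T t, Ideal.span_le]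
    rintro _ ⟨d, c, rfl, hd⟩
    obtain ⟨N, e, he⟩ := exists_pow_mul_eval d (t : K) ⟨c, hd.symm⟩ f.natDegree f hf le_rfl
    refine ⟨N, algebraMap D T e, ?_⟩
    have h1 : ((algebraMap D T e : T) : K) = algebraMap D K e := rfl
    rw [h1, he]
    push_cast
    rfl
  obtain ⟨z, hz⟩ := (Ideal.eq_top_iff_one _).mp (Ideal.radical_eq_top.mp hrad)
  exact ⟨z, by simpa using hz⟩

/-- The extension map `Pic(Int(D)) → Pic(Int(T))`, `[I] ↦ [I Int(T)]`, for a flat overring `T`. -/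
noncomputable def picExt (T : Subalgebra D K) (hT : Module.Flat D T) :
    Pic (intPoly D K) →+ Pic (intPoly T K) :=
  picMap (Subring.inclusion (intPoly_le T hT)) (Subring.inclusion_injective _)

end Overrings

end IntPic

/-! Every class of `Pic (Int(D))` is represented by an invertible ideal `I` containing a nonzero
constant `d`. This holds because the nonzero constants invert `Int(D)` to the principal ideal domain
`K[X]` (`exists_represents_constHom_mem`). If `d` is a unit of `T`, then `I Int(T) = Int(T)`, so
local finiteness puts the values of `π` in the direct sum. Injectivity of `ι_D` comes from the
retraction `f ↦ f(0)`. Let `ρ` be this retraction followed by the inclusion of constants. An ideal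
that contains a nonzero constant and has class extended from the base ring is fixed by `ρ`
(`Represents.map_constPart`). A class in the kernel of `π` thus has `ρ(I)` and `I` equal over each
`Int(T)`, and `Int(D) = ⋂ Int(T)` makes them equal (`mem_range_picInt`). For surjectivity, an ideal
`I` of `Int(T)` is contracted to `Int(D)`. The contraction is invertible, with extension `I` at `T`
and the unit ideal at the other members (`exists_picExt_eq`). The essential input is that
independence and flatness make `d T ∩ D` comaximal with the product of the nontrivial contractions
at the other members (`exists_add_eq_one`). -/

namespace IntPic

open scoped nonZeroDivisors

/-! ### Picard classes through integral invertible ideals. -/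

section Represents

variable {R : Type*} [CommRing R] [IsDomain R]

/-- The ideal `I` is invertible and its class in the Picard group is `c`. -/
def Represents (I : Ideal R) (c : Pic R) : Prop :=
  ∃ u : (FractionalIdeal R⁰ (FractionRing R))ˣ,
    (u : FractionalIdeal R⁰ (FractionRing R)) = I ∧
      Additive.ofMul (ClassGroup.mk (FractionRing R) u) = c

theorem exists_represents_of_mul_eq {I J : Ideal R} {x : R} (hx : x ≠ 0)
    (h : I * J = Ideal.span {x}) : ∃ c, Represents I c := by
  have hu : IsUnit (I : FractionalIdeal R⁰ (FractionRing R)) := by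
    have hx' : algebraMap R (FractionRing R) x ≠ 0 := by simpa using hx
    refine isUnit_of_mul_isUnit_left (y := (J : FractionalIdeal R⁰ (FractionRing R))) ?_
    rw [← FractionalIdeal.coeIdeal_mul, h, FractionalIdeal.coeIdeal_span_singleton]
    exact ⟨toPrincipalIdeal R (FractionRing R) (Units.mk0 _ hx'), by simp⟩
  exact ⟨_, hu.unit, rfl, rfl⟩

theorem exists_represents (c : Pic R) : ∃ I : Ideal R, Represents I c := by
  obtain ⟨u, hu⟩ : ∃ u, ClassGroup.mk (FractionRing R) u = c.toMul :=
    ClassGroup.induction (FractionRing R) (P := fun c => ∃ u, ClassGroup.mk (FractionRing R) u = c)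
      (fun I => ⟨I, rfl⟩) c.toMul
  have h0 : algebraMap R (FractionRing R) u.1.den ≠ 0 :=
    IsFractionRing.to_map_ne_zero_of_mem_nonZeroDivisors u.1.den.prop
  refine ⟨u.1.num, u * toPrincipalIdeal R (FractionRing R) (Units.mk0 _ h0), ?_, ?_⟩
  · rw [mul_comm, Units.val_mul, coe_toPrincipalIdeal, Units.val_mk0]
    exact FractionalIdeal.den_mul_self_eq_num' R⁰ (FractionRing R) u.1
  · rw [← ClassGroup.mk_eq_mk.mpr ⟨_, rfl⟩, hu]
    rfl

theorem exists_eq_span_singleton_mul {L : Ideal R} {x : R} (h : L ≤ Ideal.span {x}) :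
    ∃ J : Ideal R, L = Ideal.span {x} * J := by
  refine ⟨Submodule.comap (LinearMap.mulLeft R x) L, le_antisymm (fun y hy => ?_) ?_⟩
  · obtain ⟨z, rfl⟩ := Ideal.mem_span_singleton.mp (h hy)
    exact Ideal.mem_span_singleton_mul.mpr ⟨z, hy, rfl⟩
  · rw [Ideal.span_singleton_mul_le_iff]
    exact fun z hz => hz

namespace Represents

variable {I J : Ideal R} {c c' : Pic R}

theorem exists_mul_eq (h : Represents I c) :
    ∃ (J : Ideal R) (x : R), x ≠ 0 ∧ I * J = Ideal.span {x} := by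
  obtain ⟨u, hu, -⟩ := h
  refine ⟨(u⁻¹).1.num, (u⁻¹).1.den, nonZeroDivisors.ne_zero (u⁻¹).1.den.prop, ?_⟩
  apply FractionalIdeal.coeIdeal_injective (K := FractionRing R)
  dsimp only
  rw [FractionalIdeal.coeIdeal_mul, ← hu, ← FractionalIdeal.den_mul_self_eq_num',
    FractionalIdeal.coeIdeal_span_singleton, mul_left_comm, Units.mul_inv, mul_one]

theorem ne_bot (h : Represents I c) : I ≠ ⊥ := by
  obtain ⟨J, x, hx, hJ⟩ := h.exists_mul_eq
  rintro rfl
  rw [Ideal.bot_mul, eq_comm, Ideal.span_singleton_eq_bot] at hJ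
  exact hx hJ

theorem eq_iff (h : Represents I c) (h' : Represents J c') :
    c = c' ↔ ∃ x y : R, x ≠ 0 ∧ y ≠ 0 ∧ Ideal.span {x} * I = Ideal.span {y} * J := by
  obtain ⟨u, hu, rfl⟩ := h
  obtain ⟨v, hv, rfl⟩ := h'
  rw [← ClassGroup.mk_eq_mk_of_coe_ideal hu hv, Additive.ofMul.apply_eq_iff_eq]

theorem eq_zero_iff (h : Represents I c) : c = 0 ↔ ∃ x : R, x ≠ 0 ∧ I = Ideal.span {x} := by
  obtain ⟨u, hu, rfl⟩ := h
  rw [← ClassGroup.mk_eq_one_of_coe_ideal hu, ofMul_eq_zero]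

theorem eq (h : Represents I c) (h' : Represents I c') : c = c' :=
  (h.eq_iff h').mpr ⟨1, 1, one_ne_zero, one_ne_zero, rfl⟩

/-- Invertibility of `J` is inherited: if `I I' = (z)`, then `J · (y I') = (x z)`. -/
theorem of_mul_eq_mul (h : Represents I c) {x y : R} (hx : x ≠ 0) (hy : y ≠ 0)
    (hIJ : Ideal.span {x} * I = Ideal.span {y} * J) : Represents J c := by
  obtain ⟨I', z, hz, hI'⟩ := h.exists_mul_eq
  obtain ⟨c', hc'⟩ := exists_represents_of_mul_eq (I := J) (J := Ideal.span {y} * I')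
    (x := x * z) (mul_ne_zero hx hz) (by
      rw [mul_left_comm, ← mul_assoc, ← hIJ, mul_assoc, hI',
        Ideal.span_singleton_mul_span_singleton])
  rwa [(h.eq_iff hc').mpr ⟨x, y, hx, hy, hIJ⟩]

theorem map {S : Type*} [CommRing S] [IsDomain S] (h : Represents I c) (f : R →+* S)
    (hf : Function.Injective f) : Represents (I.map f) (picMap f hf c) := by
  obtain ⟨u, hu, rfl⟩ := h
  let _ : Algebra R S := f.toAlgebra
  have : FaithfulSMul R S := (faithfulSMul_iff_algebraMap_injective R S).mpr hf
  refine ⟨Units.map (FractionalIdeal.extendedHom (FractionRing S) S).toMonoidHom u, ?_, ?_⟩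
  · change FractionalIdeal.extendedHom (FractionRing S) S u.1 = _
    rw [hu]
    exact FractionalIdeal.extendedHom_coeIdeal_eq_map (FractionRing S) S I
  · exact congrArg Additive.ofMul (ClassGroup.extendedHom_mk R S u).symm

/-- If an invertible ideal contains `d`, then it divides `(d)`. -/
theorem exists_mul_eq_span (h : Represents I c) {d : R} (hd : d ∈ I) :
    ∃ J : Ideal R, I * J = Ideal.span {d} := by
  obtain ⟨I', x, hx, hI'⟩ := h.exists_mul_eq
  have hle : Ideal.span {d} * I' ≤ Ideal.span {x} := by
    rw [← hI']
    exact Ideal.mul_mono_left ((Ideal.span_singleton_le_iff_mem _).mpr hd)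
  obtain ⟨J, hJ⟩ := exists_eq_span_singleton_mul hle
  refine ⟨J, (Ideal.span_singleton_mul_right_inj hx).mp ?_⟩
  rw [mul_left_comm, ← hJ, mul_left_comm, hI', mul_comm]

end Represents

theorem picMap_picMap {R S S' A : Type*} [CommRing R] [IsDomain R] [CommRing S] [IsDomain S]
    [CommRing S'] [IsDomain S'] [CommRing A] [IsDomain A]
    (f : R →+* S) (hf : Function.Injective f) (g : S →+* A) (hg : Function.Injective g)
    (f' : R →+* S') (hf' : Function.Injective f') (g' : S' →+* A) (hg' : Function.Injective g')
    (h : g.comp f = g'.comp f') (c : Pic R) :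
    picMap g hg (picMap f hf c) = picMap g' hg' (picMap f' hf' c) := by
  obtain ⟨I, hI⟩ := exists_represents c
  have h1 := (hI.map f hf).map g hg
  have h2 := (hI.map f' hf').map g' hg'
  rw [Ideal.map_map] at h1 h2
  rw [h] at h1
  exact h1.eq h2

/-- If `I S = (x)`, applying the retraction `g` gives `I = (g x)`. -/
theorem picMap_injective_of_leftInverse {R S : Type*} [CommRing R] [IsDomain R] [CommRing S]
    [IsDomain S] (f : R →+* S) (hf : Function.Injective f) (g : S →+* R)
    (hgf : g.comp f = RingHom.id R) : Function.Injective (picMap f hf) := by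
  rw [injective_iff_map_eq_zero]
  intro c hc
  obtain ⟨I, hI⟩ := exists_represents c
  obtain ⟨x, -, hx⟩ := (hI.map f hf).eq_zero_iff.mp hc
  have h : I = Ideal.span {g x} := by
    rw [← Ideal.map_id I, ← hgf, ← Ideal.map_map, hx, Ideal.map_span, Set.image_singleton]
  refine hI.eq_zero_iff.mpr ⟨g x, fun h0 => hI.ne_bot ?_, h⟩
  rw [h, h0, Ideal.span_singleton_eq_bot]

end Represents

end IntPic

namespace IntPic

/-! ### Comaximality of contractions from independent overrings. -/

section Comaximal

variable {D K : Type*} [CommRing D] [IsDomain D] [Field K] [Algebra D K] [IsFractionRing D K]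

/-- The ideal `d T ∩ D` of `D`. -/
def contraction (T : Subalgebra D K) (d : D) : Ideal D :=
  (Ideal.span {algebraMap D T d}).comap (algebraMap D T)

theorem mem_contraction_iff {T : Subalgebra D K} {d x : D} :
    x ∈ contraction T d ↔ ∃ t ∈ T, algebraMap D K x = algebraMap D K d * t := by
  rw [contraction, Ideal.mem_comap, Ideal.mem_span_singleton]
  constructor
  · rintro ⟨t, ht⟩
    exact ⟨t, t.2, congrArg Subtype.val ht⟩
  · rintro ⟨t, ht, h⟩
    exact ⟨⟨t, ht⟩, Subtype.ext h⟩

theorem contraction_eq_top {T : Subalgebra D K} {d : D} (h : IsUnit (algebraMap D T d)) :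
    contraction T d = ⊤ := by
  rw [contraction, Ideal.span_singleton_eq_top.mpr h, Ideal.comap_top]

theorem contraction_mul_le (T : Subalgebra D K) (c d : D) :
    contraction T (c * d) ≤ contraction T c := by
  rw [contraction, contraction, map_mul]
  exact Ideal.comap_mono (Ideal.span_singleton_le_span_singleton.mpr (dvd_mul_right _ _))

/-- If `T` and `T'` are independent and `T'` is flat, then `(d T ∩ D) T' = T'`. -/
theorem map_contraction_eq_top {T T' : Subalgebra D K} (hT' : Module.Flat D T')
    (h : Subalgebra.toSubmodule T * Subalgebra.toSubmodule T' = ⊤) {d : D} (hd : d ≠ 0) :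
    (contraction T d).map (algebraMap D T') = ⊤ := by
  have hdK : algebraMap D K d ≠ 0 := by simpa using hd
  have hmem : (algebraMap D K d)⁻¹ ∈ Subalgebra.toSubmodule T * Subalgebra.toSubmodule T' := by
    rw [h]; trivial
  obtain ⟨ι, _, t, s, hts⟩ : ∃ (ι : Type) (_ : Fintype ι) (t : ι → T) (s : ι → T'),
      (algebraMap D K d)⁻¹ = ∑ i, (t i : K) * s i := by
    refine Submodule.mul_induction_on hmem (fun t ht s hs => ?_) ?_
    · exact ⟨Unit, inferInstance, fun _ => ⟨t, ht⟩, fun _ => ⟨s, hs⟩, by simp⟩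
    · rintro _ _ ⟨ι, _, t, s, rfl⟩ ⟨κ, _, t', s', rfl⟩
      exact ⟨ι ⊕ κ, inferInstance, Sum.elim t t', Sum.elim s s', by simp⟩
  -- With `1 = ∑ (d tᵢ) sᵢ`, a common denominator `e` gives `e d tᵢ = uᵢ ∈ D`, hence a `D`-linear
  -- relation `e · 1 - ∑ uᵢ sᵢ = 0` in `T'`. Flatness writes `1 = ∑ c₀ⱼ yⱼ` with `e c₀ⱼ = ∑ uᵢ cᵢⱼ`,
  -- so that `c₀ⱼ = d ∑ cᵢⱼ tᵢ ∈ d T ∩ D`.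
  obtain ⟨e, he⟩ := IsLocalization.exist_integer_multiples_of_finite (nonZeroDivisors D)
    (fun i => algebraMap D K d * (t i : K))
  choose u hu using he
  have heK : algebraMap D K e ≠ 0 := IsFractionRing.to_map_ne_zero_of_mem_nonZeroDivisors e.2
  have hrel : ∑ i : Option ι, (fun i => i.elim (e : D) fun j => -u j) i •
      (fun i => i.elim (1 : T') s) i = 0 := by
    apply Subtype.ext
    have h1 : ∑ i, algebraMap D K (u i) * (s i : K) = algebraMap D K e := by
      simp only [hu, Algebra.smul_def, mul_assoc, ← Finset.mul_sum, ← hts]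
      rw [mul_inv_cancel₀ hdK, mul_one]
    simp [Fintype.sum_option, Algebra.smul_def, h1]
  obtain ⟨k, c, y, hy, hc⟩ := Module.Flat.isTrivialRelation_of_sum_smul_eq_zero hrel
  rw [Ideal.eq_top_iff_one]
  have h1 : (1 : T') = ∑ j, c none j • y j := by simpa using hy none
  rw [h1]
  refine sum_mem fun j _ => ?_
  rw [Algebra.smul_def]
  refine Ideal.mul_mem_right _ _ (Ideal.mem_map_of_mem _ (mem_contraction_iff.mpr
    ⟨∑ i, c (some i) j • (t i : K), sum_mem fun i _ => T.smul_mem (t i).2 _, ?_⟩))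
  have hj := congrArg (algebraMap D K) (hc j)
  simp only [Fintype.sum_option, Option.elim, neg_mul, Finset.sum_neg_distrib, map_add, map_mul,
    map_neg, map_sum, map_zero, hu, Algebra.smul_def] at hj
  apply mul_left_cancel₀ heK
  rw [eq_neg_of_add_eq_zero_left hj, neg_neg, Finset.mul_sum, Finset.mul_sum]
  refine Finset.sum_congr rfl fun i _ => ?_
  rw [Algebra.smul_def]
  ring

namespace IsPreJaffardFamily

variable {Θ : Set (Subalgebra D K)}

theorem mem_range_of_forall_mem (hΘ : IsPreJaffardFamily Θ) {x : K} (h : ∀ T ∈ Θ, x ∈ T) :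
    x ∈ (algebraMap D K).range := by
  have h1 := hΘ.complete ⊤
  have h2 : x ∈ algebraMap D K '' ((⊤ : Ideal D) : Set D) := by
    rw [h1]
    intro T hT
    have : (1 : K) ∈ Submodule.span T (algebraMap D K '' ((⊤ : Ideal D) : Set D)) :=
      Submodule.subset_span ⟨1, trivial, map_one _⟩
    simpa [Algebra.smul_def] using Submodule.smul_mem _ (⟨x, h T hT⟩ : T) this
  obtain ⟨y, -, hy⟩ := h2
  exact ⟨y, hy⟩

theorem eq_top_of_forall_map_eq_top (hΘ : IsPreJaffardFamily Θ) {I : Ideal D}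
    (h : ∀ T ∈ Θ, I.map (algebraMap D T) = ⊤) : I = ⊤ := by
  have h2 : (1 : K) ∈ algebraMap D K '' (I : Set D) := by
    rw [hΘ.complete I]
    intro T hT
    have h1 : (1 : T) ∈ I.map (algebraMap D T) := by rw [h T hT]; trivial
    have h3 := Submodule.mem_map_of_mem (f := Algebra.linearMap T K) h1
    rw [Ideal.map, Ideal.span, Submodule.map_span, ← Set.image_comp] at h3
    rw [Algebra.linearMap_apply, map_one] at h3
    exact h3
  obtain ⟨y, hy, hy1⟩ := h2
  rw [Ideal.eq_top_iff_one]
  have h1 : y = 1 := IsFractionRing.injective D K (by simpa using hy1)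
  exact h1 ▸ hy

end IsPreJaffardFamily

namespace IsJaffardFamily

variable {Θ : Set (Subalgebra D K)}

/-- For `d ≠ 0` in `D` and `T` in a Jaffard family, `1` is the sum of an element of `d T` and an
element that lies in `d T'` for all other members `T'` of the family. -/
theorem exists_add_eq_one (hΘ : IsJaffardFamily Θ) {T : Subalgebra D K} (hT : T ∈ Θ) {d : D}
    (hd : d ≠ 0) : ∃ a b : D, a + b = 1 ∧ a ∈ contraction T d ∧
      ∀ T' ∈ Θ, T' ≠ T → b ∈ contraction T' d := by
  classical
  set s : Finset (Subalgebra D K) := (hΘ.locallyFinite d hd).toFinset.erase T with hs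
  have hsm : ∀ T', T' ∈ s ↔ T' ≠ T ∧ T' ∈ Θ ∧ ¬ IsUnit (algebraMap D T' d) := by
    intro T'
    simp [hs]
  set B : Ideal D := ∏ T' ∈ s, contraction T' d with hB
  -- Checked after extension to each member: over `T` all factors of `B` become trivial, and over
  -- any other member `contraction T d` does.
  have htop : contraction T d ⊔ B = ⊤ := by
    apply hΘ.toIsPreJaffardFamily.eq_top_of_forall_map_eq_top
    intro T'' hT''
    rw [Ideal.map_sup]
    by_cases hTT : T'' = T
    · subst hTT
      have : B.map (algebraMap D T'') = ⊤ := by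
        rw [hB, ← Ideal.mapHom_apply, map_prod, ← Ideal.one_eq_top]
        refine Finset.prod_eq_one fun T' hT' => ?_
        obtain ⟨h1, h2, -⟩ := (hsm T').mp hT'
        rw [Ideal.mapHom_apply, Ideal.one_eq_top]
        exact map_contraction_eq_top (hΘ.flat _ hT'') (hΘ.independent _ h2 _ hT'' h1) hd
      rw [this, sup_top_eq]
    · rw [map_contraction_eq_top (hΘ.flat _ hT'')
        (hΘ.independent _ hT _ hT'' (Ne.symm hTT)) hd, top_sup_eq]
  obtain ⟨a, ha, b, hb, hab⟩ := Submodule.mem_sup.mp ((Ideal.eq_top_iff_one _).mp htop)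
  refine ⟨a, b, hab, ha, fun T' hT' hne => ?_⟩
  by_cases hu : IsUnit (algebraMap D T' d)
  · rw [contraction_eq_top hu]; trivial
  · exact (Ideal.prod_le_inf.trans (Finset.inf_le ((hsm T').mpr ⟨hne, hT', hu⟩))) hb

end IsJaffardFamily

end Comaximal

end IntPic

namespace IntPic

/-! ### Constants in `Int(D)` and ideals generated by them. -/

section IntegerValued

variable {D K : Type*} [CommRing D] [IsDomain D] [Field K] [Algebra D K] [IsFractionRing D K]

@[simp]
theorem coe_constHom (d : D) : (constHom D K d : K[X]) = Polynomial.C (algebraMap D K d) := rfl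

theorem constHom_ne_zero {d : D} (hd : d ≠ 0) : constHom D K d ≠ 0 :=
  (map_ne_zero_iff _ (constHom_injective D K)).mpr hd

variable (D K) in
/-- Evaluation at `0`, as a ring homomorphism `Int(D) → D`. -/
noncomputable def evalZero : intPoly D K →+* D :=
  (RingEquiv.ofBijective (algebraMap D K).rangeRestrict
    ⟨fun _ _ h => IsFractionRing.injective D K (congrArg Subtype.val h),
      (algebraMap D K).rangeRestrict_surjective⟩).symm.toRingHom.comp
    (((Polynomial.evalRingHom (0 : K)).comp (intPoly D K).subtype).codRestrict
      (algebraMap D K).range fun f => by simpa using f.2 0)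

theorem algebraMap_evalZero (f : intPoly D K) :
    algebraMap D K (evalZero D K f) = (f : K[X]).eval 0 := by
  set x : (algebraMap D K).range := (((Polynomial.evalRingHom (0 : K)).comp
    (intPoly D K).subtype).codRestrict
      (algebraMap D K).range fun f => by simpa using f.2 0) f
  exact congrArg Subtype.val ((RingEquiv.ofBijective (algebraMap D K).rangeRestrict
    ⟨fun _ _ h => IsFractionRing.injective D K (congrArg Subtype.val h),
      (algebraMap D K).rangeRestrict_surjective⟩).apply_symm_apply x)

theorem evalZero_comp_constHom : (evalZero D K).comp (constHom D K) = RingHom.id D := by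
  ext d
  apply IsFractionRing.injective D K
  simp [algebraMap_evalZero]

variable (D K) in
theorem picInt_injective : Function.Injective (picInt D K) :=
  picMap_injective_of_leftInverse _ _ (evalZero D K) evalZero_comp_constHom

variable (D K) in
/-- The retraction `f ↦ f(0)` of `Int(D)` onto the constants. -/
noncomputable def constPart : intPoly D K →+* intPoly D K :=
  (constHom D K).comp (evalZero D K)

@[simp]
theorem coe_constPart (f : intPoly D K) :
    (constPart D K f : K[X]) = Polynomial.C ((f : K[X]).eval 0) := by
  rw [constPart, RingHom.comp_apply, coe_constHom, algebraMap_evalZero]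

theorem constPart_comp_constHom : (constPart D K).comp (constHom D K) = constHom D K := by
  rw [constPart, RingHom.comp_assoc, evalZero_comp_constHom, RingHom.comp_id]

variable (D) in
theorem exists_C_mul_mem_intPoly (p : K[X]) :
    ∃ d : D, d ≠ 0 ∧ Polynomial.C (algebraMap D K d) * p ∈ intPoly D K := by
  obtain ⟨b, hb, hbp⟩ := IsLocalization.integerNormalization_spec (nonZeroDivisors D) p
  refine ⟨b, nonZeroDivisors.ne_zero hb, fun x => ?_⟩
  refine ⟨(IsLocalization.integerNormalization (nonZeroDivisors D) p).eval x, ?_⟩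
  rw [← Polynomial.eval₂_at_apply, ← Polynomial.eval_map, hbp]
  simp [Algebra.smul_def]

theorem exists_mem_eq_C_mul {I : Ideal (intPoly D K)} {p : K[X]}
    (hp : p ∈ I.map (intPoly D K).subtype) :
    ∃ d : D, d ≠ 0 ∧ ∃ i ∈ I, (i : K[X]) = Polynomial.C (algebraMap D K d) * p := by
  induction hp using Submodule.span_induction with
  | mem x hx =>
    obtain ⟨i, hi, rfl⟩ := hx
    exact ⟨1, one_ne_zero, i, hi, by simp⟩
  | zero => exact ⟨1, one_ne_zero, 0, I.zero_mem, by simp⟩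
  | add x y _ _ hx hy =>
    obtain ⟨d, hd, i, hi, hix⟩ := hx
    obtain ⟨e, he, j, hj, hjy⟩ := hy
    refine ⟨d * e, mul_ne_zero hd he, constHom D K e * i + constHom D K d * j,
      I.add_mem (I.mul_mem_left _ hi) (I.mul_mem_left _ hj), ?_⟩
    rw [Subring.coe_add, Subring.coe_mul, Subring.coe_mul, hix, hjy, coe_constHom, coe_constHom,
      map_mul, Polynomial.C_mul]
    ring
  | smul a x _ hx =>
    obtain ⟨d, hd, i, hi, hix⟩ := hx
    obtain ⟨e, he, hea⟩ := exists_C_mul_mem_intPoly D a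
    refine ⟨d * e, mul_ne_zero hd he, ⟨_, hea⟩ * i, I.mul_mem_left _ hi, ?_⟩
    rw [Subring.coe_mul, hix, map_mul, Polynomial.C_mul, smul_eq_mul]
    ring

/-- Every class in `Pic(Int(D))` is represented by an ideal that contains a nonzero constant. -/
theorem exists_represents_constHom_mem (c : Pic (intPoly D K)) :
    ∃ I : Ideal (intPoly D K), Represents I c ∧ ∃ d : D, d ≠ 0 ∧ constHom D K d ∈ I := by
  obtain ⟨I, hI⟩ := exists_represents c
  obtain ⟨I', x, hx, hII'⟩ := hI.exists_mul_eq
  set φ := (intPoly D K).subtype with hφ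
  have hφinj : Function.Injective φ := Subtype.val_injective
  obtain ⟨f, hf⟩ := (IsPrincipalIdealRing.principal (I.map φ)).principal
  obtain ⟨g, hg⟩ := (IsPrincipalIdealRing.principal (I'.map φ)).principal
  rw [Ideal.submodule_span_eq] at hf hg
  have hfg : Ideal.span {φ x} = Ideal.span {f * g} := by
    rw [← Ideal.span_singleton_mul_span_singleton, ← hf, ← hg, ← Ideal.map_mul, hII',
      Ideal.map_span, Set.image_singleton]
  -- Since `x = f g v`, clearing denominators of `f` and `g v` produces `i ∈ I` and `i' ∈ I'` with
  -- `i i' = e e' x`.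
  obtain ⟨v, hv⟩ := Ideal.mem_span_singleton.mp (hfg ▸ Ideal.mem_span_singleton_self (φ x))
  obtain ⟨e, he, i, hi, hif⟩ := exists_mem_eq_C_mul (I := I) (p := f)
    (hf ▸ Ideal.mem_span_singleton_self f)
  obtain ⟨e', he', i', hi', hig⟩ := exists_mem_eq_C_mul (I := I') (p := g * v)
    (Ideal.mul_mem_right _ _ (hg ▸ Ideal.mem_span_singleton_self g))
  have hii' : i * i' = constHom D K (e * e') * x := by
    apply hφinj
    change (i : K[X]) * (i' : K[X]) = (constHom D K (e * e') : K[X]) * φ x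
    rw [hif, hig, hv, coe_constHom, map_mul, Polynomial.C_mul]
    ring
  have hee' : e * e' ≠ 0 := mul_ne_zero he he'
  have hne : i * i' ≠ 0 := by
    rw [hii']
    exact mul_ne_zero (constHom_ne_zero hee') hx
  have hi0 : i ≠ 0 := left_ne_zero_of_mul hne
  -- For `p ∈ I`, `p i' = r x`; multiplying by `e e'` and cancelling `i'` gives `e e' p = r i`.
  -- Hence `e e' I = i J`, and `i ∈ I` puts the constant `e e'` in `J`.
  have hle : Ideal.span {constHom D K (e * e')} * I ≤ Ideal.span {i} := by
    rw [Ideal.span_singleton_mul_le_iff]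
    intro p hp
    have hpi : p * i' ∈ Ideal.span {x} := hII' ▸ Ideal.mul_mem_mul hp hi'
    obtain ⟨r, hr⟩ := Ideal.mem_span_singleton.mp hpi
    refine Ideal.mem_span_singleton.mpr ⟨r, mul_right_cancel₀ (right_ne_zero_of_mul hne) ?_⟩
    linear_combination constHom D K (e * e') * hr - r * hii'
  obtain ⟨J, hJ⟩ := exists_eq_span_singleton_mul hle
  refine ⟨J, hI.of_mul_eq_mul (constHom_ne_zero hee') hi0 hJ, e * e', hee', ?_⟩
  obtain ⟨z, hz, hzi⟩ := Ideal.mem_span_singleton_mul.mp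
    (hJ ▸ Ideal.mul_mem_mul (Ideal.mem_span_singleton_self _) hi)
  rw [mul_comm] at hzi
  rwa [← mul_right_cancel₀ hi0 hzi]

/-- An ideal of `Int(D)` that contains a nonzero constant and whose class is extended from `D` is
itself generated by constants. -/
theorem Represents.map_constPart {I : Ideal (intPoly D K)} {c : Pic D}
    (h : Represents I (picInt D K c)) {d : D} (hd : d ≠ 0) (hdI : constHom D K d ∈ I) :
    I.map (constPart D K) = I := by
  obtain ⟨I₀, hI₀⟩ := exists_represents c
  obtain ⟨x, y, hx, hy, hxy⟩ := (h.eq_iff (hI₀.map _ (constHom_injective D K))).mp rfl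
  obtain ⟨t, ht, ht0⟩ := Submodule.exists_mem_ne_zero_of_ne_bot hI₀.ne_bot
  obtain ⟨z, -, hz⟩ := Ideal.mem_span_singleton_mul.mp
    (hxy.symm ▸ Ideal.mul_mem_mul (Ideal.mem_span_singleton_self y)
      (Ideal.mem_map_of_mem (constHom D K) ht))
  obtain ⟨w, -, hw⟩ := Ideal.mem_span_singleton_mul.mp
    (hxy ▸ Ideal.mul_mem_mul (Ideal.mem_span_singleton_self x) hdI)
  -- `x z = y t` and `y w = x d`. A product of two polynomials that is a nonzero constant has
  -- constant factors, so the multiplier `y / x = z / t` is a ratio of constants.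
  have hzw : z * w = constHom D K (t * d) := by
    apply mul_left_cancel₀ hx
    rw [map_mul]
    linear_combination w * hz + constHom D K t * hw
  have hzw0 : constHom D K (t * d) ≠ 0 := constHom_ne_zero (mul_ne_zero ht0 hd)
  have hz0 : z ≠ 0 := left_ne_zero_of_mul (hzw ▸ hzw0)
  have hw0 : w ≠ 0 := right_ne_zero_of_mul (hzw ▸ hzw0)
  have hdeg : (z : K[X]).natDegree = 0 := by
    have h1 : (z : K[X]) * (w : K[X]) = Polynomial.C (algebraMap D K (t * d)) :=
      congrArg Subtype.val hzw
    have h2 := congrArg Polynomial.natDegree h1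
    rw [Polynomial.natDegree_mul (fun h => hz0 (Subtype.ext h)) (fun h => hw0 (Subtype.ext h)),
      Polynomial.natDegree_C] at h2
    omega
  obtain ⟨s, hs⟩ : ∃ s : D, z = constHom D K s := by
    refine ⟨evalZero D K z, Subtype.ext ?_⟩
    rw [coe_constHom, algebraMap_evalZero, ← Polynomial.coeff_zero_eq_eval_zero]
    exact Polynomial.eq_C_of_natDegree_eq_zero hdeg
  subst hs
  have key : Ideal.span {constHom D K t} * I =
      Ideal.span {constHom D K s} * I₀.map (constHom D K) := by
    apply (Ideal.span_singleton_mul_right_inj hx).mp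
    rw [mul_left_comm, hxy, ← mul_assoc, ← mul_assoc, Ideal.span_singleton_mul_span_singleton,
      Ideal.span_singleton_mul_span_singleton, hz, mul_comm y]
  have key' := congrArg (Ideal.map (constPart D K)) key
  rw [Ideal.map_mul, Ideal.map_mul, Ideal.map_span, Ideal.map_span, Set.image_singleton,
    Set.image_singleton, Ideal.map_map, ← RingHom.comp_apply, ← RingHom.comp_apply,
    constPart_comp_constHom, ← key] at key'
  exact (Ideal.span_singleton_mul_right_inj (constHom_ne_zero ht0)).mp key'

end IntegerValued

end IntPic

namespace IntPic

/-! ### Passage between `Int(D)` and `Int(T)`. -/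

section Extension

variable {D K : Type*} [CommRing D] [IsDomain D] [Field K] [Algebra D K] [IsFractionRing D K]

/-- The inclusion `Int(D) → Int(T)`, for a flat overring `T`. -/
noncomputable def intInclusion (T : Subalgebra D K) (hT : Module.Flat D T) :
    intPoly D K →+* intPoly T K :=
  Subring.inclusion (intPoly_le T hT)

@[simp]
theorem coe_intInclusion (T : Subalgebra D K) (hT : Module.Flat D T) (f : intPoly D K) :
    (intInclusion T hT f : K[X]) = f := rfl

theorem Represents.map_intInclusion {I : Ideal (intPoly D K)} {c : Pic (intPoly D K)}
    (h : Represents I c) (T : Subalgebra D K) (hT : Module.Flat D T) :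
    Represents (I.map (intInclusion T hT)) (picExt T hT c) :=
  h.map _ _

theorem intInclusion_constHom (T : Subalgebra D K) (hT : Module.Flat D T) (d : D) :
    intInclusion T hT (constHom D K d) = constHom T K (algebraMap D T d) := rfl

theorem intInclusion_comp_constPart (T : Subalgebra D K) (hT : Module.Flat D T) :
    (intInclusion T hT).comp (constPart D K) = (constPart T K).comp (intInclusion T hT) := by
  ext f : 1
  apply Subtype.ext
  simp

theorem picExt_picInt (T : Subalgebra D K) (hT : Module.Flat D T) (c : Pic D) :
    picExt T hT (picInt D K c) ∈ (picInt T K).range := by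
  have hinj : Function.Injective (algebraMap D T) := FaithfulSMul.algebraMap_injective D T
  have hcomp : (constHom T K).comp (algebraMap D T) =
      (Subring.inclusion (intPoly_le T hT)).comp (constHom D K) :=
    RingHom.ext fun d => (intInclusion_constHom T hT d).symm
  exact ⟨picMap (algebraMap D T) hinj c, picMap_picMap (algebraMap D T) hinj (constHom T K)
    (constHom_injective T K) (constHom D K) (constHom_injective D K)
    (Subring.inclusion (intPoly_le T hT)) (Subring.inclusion_injective _) hcomp c⟩

theorem map_intInclusion_eq_top {I : Ideal (intPoly D K)} {d : D} (hd : constHom D K d ∈ I)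
    {T : Subalgebra D K} (hT : Module.Flat D T) (hu : IsUnit (algebraMap D T d)) :
    I.map (intInclusion T hT) = ⊤ := by
  refine Ideal.eq_top_of_isUnit_mem _ (Ideal.mem_map_of_mem _ hd) ?_
  rw [intInclusion_constHom]
  exact hu.map _

theorem C_mul_mem_intPoly (T : Subalgebra D K) (d : D) {f : K[X]} (hf : f ∈ intPoly T K) :
    Polynomial.C (algebraMap D K d) * f ∈ intPoly T K :=
  mul_mem (constHom T K (algebraMap D T d)).2 hf

theorem mem_contraction_mul {T : Subalgebra D K} {b c e : D} (hb : b ∈ contraction T (c * e))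
    {f : K[X]} (hf : Polynomial.C (algebraMap D K e) * f ∈ intPoly T K) :
    ∃ r ∈ intPoly T K, Polynomial.C (algebraMap D K b) * f =
      Polynomial.C (algebraMap D K c) * r := by
  obtain ⟨t, ht, hbt⟩ := mem_contraction_iff.mp hb
  refine ⟨(constHom T K ⟨t, ht⟩ : K[X]) * _, mul_mem (Subtype.prop _) hf, ?_⟩
  rw [hbt, coe_constHom]
  simp only [map_mul]
  change _ = _ * (Polynomial.C t * _)
  ring

/-! ### Gluing over the family and exactness in the middle. -/

namespace IsPreJaffardFamily

variable {Θ : Set (Subalgebra D K)}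

theorem mem_intPoly_of_forall_mem (hΘ : IsPreJaffardFamily Θ) {f : K[X]}
    (h : ∀ T ∈ Θ, f ∈ intPoly T K) : f ∈ intPoly D K := by
  intro d
  apply hΘ.mem_range_of_forall_mem
  intro T hT
  obtain ⟨t, ht⟩ := h T hT (algebraMap D T d)
  rw [← IsScalarTower.algebraMap_apply] at ht
  rw [← ht]
  exact t.2

/-- Dividing by `d` reduces this to `⋂ Int(T) ⊆ Int(D)`. General ideals are not claimed to be
determined locally, so later arguments multiply until the target is `(d)`. -/
theorem mem_span_of_forall_mem (hΘ : IsPreJaffardFamily Θ) {d : D} (hd : d ≠ 0)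
    {f : intPoly D K} (h : ∀ (T) (hT : T ∈ Θ), intInclusion T (hΘ.flat T hT) f ∈
      Ideal.span {constHom T K (algebraMap D T d)}) : f ∈ Ideal.span {constHom D K d} := by
  have hdK : algebraMap D K d ≠ 0 := by simpa using hd
  have hC : Polynomial.C (algebraMap D K d) ≠ 0 := by simpa using hd
  have hf : (f : K[X]) = Polynomial.C (algebraMap D K d) *
      (Polynomial.C (algebraMap D K d)⁻¹ * f) := by
    rw [← mul_assoc, ← map_mul, mul_inv_cancel₀ hdK, map_one, one_mul]
  have hmem : Polynomial.C (algebraMap D K d)⁻¹ * (f : K[X]) ∈ intPoly D K := by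
    apply hΘ.mem_intPoly_of_forall_mem
    intro T hT
    obtain ⟨r, hr⟩ := Ideal.mem_span_singleton.mp (h T hT)
    have hr' : (f : K[X]) = Polynomial.C (algebraMap D K d) * r := congrArg Subtype.val hr
    rw [mul_left_cancel₀ hC (hf.symm.trans hr')]
    exact r.2
  exact Ideal.mem_span_singleton.mpr ⟨⟨_, hmem⟩, Subtype.ext hf⟩

theorem mem_range_picInt (hΘ : IsPreJaffardFamily Θ) {c : Pic (intPoly D K)}
    (h : ∀ (T) (hT : T ∈ Θ), picExt T (hΘ.flat T hT) c ∈ (picInt T K).range) :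
    c ∈ (picInt D K).range := by
  obtain ⟨I, hI, d, hd, hdI⟩ := exists_represents_constHom_mem c
  obtain ⟨J, hJ⟩ := hI.exists_mul_eq_span hdI
  have hloc : ∀ (T) (hT : T ∈ Θ), (I.map (constPart D K)).map (intInclusion T (hΘ.flat T hT)) =
      I.map (intInclusion T (hΘ.flat T hT)) := by
    intro T hT
    obtain ⟨c₀, hc₀⟩ := h T hT
    have h1 := hI.map_intInclusion T (hΘ.flat T hT)
    rw [← hc₀] at h1
    have hdT : algebraMap D T d ≠ 0 :=
      (map_ne_zero_iff _ (FaithfulSMul.algebraMap_injective D T)).mpr hd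
    rw [Ideal.map_map, intInclusion_comp_constPart, ← Ideal.map_map]
    exact h1.map_constPart hdT (Ideal.mem_map_of_mem (intInclusion T (hΘ.flat T hT)) hdI)
  have hρ : constPart D K (constHom D K d) = constHom D K d :=
    RingHom.congr_fun constPart_comp_constHom d
  have hMJ : I.map (constPart D K) * J.map (constPart D K) = Ideal.span {constHom D K d} := by
    rw [← Ideal.map_mul, hJ, Ideal.map_span, Set.image_singleton, hρ]
  have hle : ∀ L : Ideal (intPoly D K), (∀ (T) (hT : T ∈ Θ),
      L.map (intInclusion T (hΘ.flat T hT)) = (Ideal.span {constHom D K d}).map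
        (intInclusion T (hΘ.flat T hT))) → L ≤ Ideal.span {constHom D K d} := by
    intro L hL q hq
    apply hΘ.mem_span_of_forall_mem hd
    intro T hT
    have h1 := Ideal.mem_map_of_mem (intInclusion T (hΘ.flat T hT)) hq
    rwa [hL T hT, Ideal.map_span, Set.image_singleton] at h1
  -- Over every `Int(T)`, `ρ(I)` may be replaced by `I`, so both mixed products become `(d)` there.
  have h1 : I.map (constPart D K) * J ≤ Ideal.span {constHom D K d} :=
    hle _ fun T hT => by rw [Ideal.map_mul, hloc T hT, ← Ideal.map_mul, hJ]
  have h2 : I * J.map (constPart D K) ≤ Ideal.span {constHom D K d} :=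
    hle _ fun T hT => by rw [Ideal.map_mul, ← hloc T hT, ← Ideal.map_mul, hMJ]
  have hd' := constHom_ne_zero (K := K) hd
  have heq : I.map (constPart D K) = I := by
    apply le_antisymm
    · rw [← Ideal.span_singleton_mul_right_mono hd']
      calc _ = I * (I.map (constPart D K) * J) := by rw [← hJ]; ring
        _ ≤ I * Ideal.span {constHom D K d} := Ideal.mul_mono_right h1
        _ = _ := mul_comm _ _
    · rw [← Ideal.span_singleton_mul_right_mono hd']
      calc _ = I.map (constPart D K) * (I * J.map (constPart D K)) := by rw [← hMJ]; ring
        _ ≤ I.map (constPart D K) * Ideal.span {constHom D K d} := Ideal.mul_mono_right h2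
        _ = _ := mul_comm _ _
  -- As `ρ(I) = I`, the ideal `I` is extended from its image in `D` under `f ↦ f(0)`, which is
  -- invertible because `I J = (d)` maps to `(d)`.
  obtain ⟨c₀, hc₀⟩ := exists_represents_of_mul_eq (I := I.map (evalZero D K))
    (J := J.map (evalZero D K)) hd (by
      rw [← Ideal.map_mul, hJ, Ideal.map_span, Set.image_singleton]
      exact congrArg (fun x => Ideal.span {x}) (RingHom.congr_fun evalZero_comp_constHom d))
  have h3 := hc₀.map (constHom D K) (constHom_injective D K)
  rw [Ideal.map_map] at h3
  exact ⟨c₀, h3.eq (heq.symm ▸ hI)⟩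

/-- The elements of `L ∩ Int(D)` that lie in `d Int(S)` for all members `S ≠ T` of the family. -/
noncomputable def complement (hΘ : IsPreJaffardFamily Θ)
    {T : Subalgebra D K} (hT : T ∈ Θ) (L : Ideal (intPoly T K)) (d : D) : Ideal (intPoly D K) :=
  L.comap (intInclusion T (hΘ.flat T hT)) ⊓ ⨅ (S : Θ) (_ : S.1 ≠ T),
    (Ideal.span {constHom S.1 K (algebraMap D S.1 d)}).comap
      (intInclusion S.1 (hΘ.flat S.1 S.2))

theorem mem_complement_iff {hΘ : IsPreJaffardFamily Θ}
    {T : Subalgebra D K} {hT : T ∈ Θ} {L : Ideal (intPoly T K)} {d : D} {g : intPoly D K} :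
    g ∈ hΘ.complement hT L d ↔ intInclusion T (hΘ.flat T hT) g ∈ L ∧
      ∀ (S) (hS : S ∈ Θ), S ≠ T →
        intInclusion S (hΘ.flat S hS) g ∈ Ideal.span {constHom S K (algebraMap D S d)} := by
  simp only [complement, Submodule.mem_inf, Submodule.mem_iInf,
    Ideal.mem_comap, Subtype.forall]

end IsPreJaffardFamily

/-! ### Finite support and lifting of local classes. -/

namespace IsJaffardFamily

variable {Θ : Set (Subalgebra D K)}

theorem finite_picExt_ne_zero (hΘ : IsJaffardFamily Θ) (c : Pic (intPoly D K)) :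
    {T : Θ | picExt T.1 (hΘ.flat T.1 T.2) c ≠ 0}.Finite := by
  obtain ⟨I, hI, d, hd, hdI⟩ := exists_represents_constHom_mem c
  refine Set.Finite.of_finite_image ((hΘ.locallyFinite d hd).subset ?_)
    (Subtype.val_injective.injOn)
  rintro _ ⟨T, hT, rfl⟩
  refine ⟨T.2, fun hu => hT ?_⟩
  refine (hI.map_intInclusion T.1 (hΘ.flat T.1 T.2)).eq_zero_iff.mpr ⟨1, one_ne_zero, ?_⟩
  rw [map_intInclusion_eq_top hdI _ hu, Ideal.span_singleton_one]

/-- An element of `I L` is moved into `(I ∩ Int(D)) · complement(L)` by the square of any `b ∈ D`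
that is sufficiently divisible in the other members of the family. -/
theorem exists_mem_mul_complement (hΘ : IsJaffardFamily Θ) {T : Subalgebra D K} (hT : T ∈ Θ)
    {I L : Ideal (intPoly T K)} {d : D} (hd : d ≠ 0) {h : intPoly T K} (hh : h ∈ I * L) :
    ∃ e : D, e ≠ 0 ∧ ∀ b : D, (∀ S ∈ Θ, S ≠ T → b ∈ contraction S e) →
      ∃ y ∈ I.comap (intInclusion T (hΘ.flat T hT)) *
          hΘ.toIsPreJaffardFamily.complement hT L d,
        (y : K[X]) = Polynomial.C (algebraMap D K b) ^ 2 * h := by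
  refine Submodule.mul_induction_on hh (fun f hf g hg => ?_) ?_
  · obtain ⟨e₁, he₁, hf₁⟩ := exists_C_mul_mem_intPoly D (f : K[X])
    obtain ⟨e₂, he₂, hg₂⟩ := exists_C_mul_mem_intPoly D (g : K[X])
    -- `e₁` makes `b f` integer-valued at `S ≠ T`, `e₂` does so for `b g`, and the extra `d` puts `b
    -- g` in `d Int(S)`. The two factors `b f` and `b g` account for the square of `b`.
    refine ⟨d * e₂ * e₁, mul_ne_zero (mul_ne_zero hd he₂) he₁, fun b hb => ?_⟩
    have hbf : Polynomial.C (algebraMap D K b) * (f : K[X]) ∈ intPoly D K := by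
      apply hΘ.toIsPreJaffardFamily.mem_intPoly_of_forall_mem
      intro S hS
      by_cases hST : S = T
      · subst hST
        exact C_mul_mem_intPoly S b f.2
      · obtain ⟨r, hr, hbr⟩ := mem_contraction_mul (hb S hS hST)
          (intPoly_le S (hΘ.flat S hS) hf₁)
        rw [hbr]
        exact C_mul_mem_intPoly S (d * e₂) hr
    have hbg : ∀ S ∈ Θ, S ≠ T → ∃ r ∈ intPoly S K,
        Polynomial.C (algebraMap D K b) * (g : K[X]) =
          Polynomial.C (algebraMap D K d) * r := fun S hS hST =>
      mem_contraction_mul (contraction_mul_le _ _ _ (hb S hS hST))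
        (intPoly_le S (hΘ.flat S hS) hg₂)
    have hbg' : Polynomial.C (algebraMap D K b) * (g : K[X]) ∈ intPoly D K := by
      apply hΘ.toIsPreJaffardFamily.mem_intPoly_of_forall_mem
      intro S hS
      by_cases hST : S = T
      · subst hST
        exact C_mul_mem_intPoly S b g.2
      · obtain ⟨r, hr, hbr⟩ := hbg S hS hST
        rw [hbr]
        exact C_mul_mem_intPoly S d hr
    refine ⟨⟨_, hbf⟩ * ⟨_, hbg'⟩, Ideal.mul_mem_mul ?_
      (hΘ.toIsPreJaffardFamily.mem_complement_iff.mpr ⟨?_, ?_⟩), ?_⟩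
    · exact I.mul_mem_left (constHom T K (algebraMap D T b)) hf
    · exact L.mul_mem_left (constHom T K (algebraMap D T b)) hg
    · intro S hS hST
      obtain ⟨r, hr, hbr⟩ := hbg S hS hST
      exact Ideal.mem_span_singleton.mpr ⟨⟨r, hr⟩, Subtype.ext hbr⟩
    · simp only [Subring.coe_mul]
      ring
  · rintro x y ⟨e₁, he₁, h₁⟩ ⟨e₂, he₂, h₂⟩
    refine ⟨e₁ * e₂, mul_ne_zero he₁ he₂, fun b hb => ?_⟩
    obtain ⟨u, hu, hux⟩ := h₁ b fun S hS hST => contraction_mul_le _ _ _ (hb S hS hST)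
    obtain ⟨v, hv, hvy⟩ := h₂ b fun S hS hST =>
      contraction_mul_le S e₂ e₁ (mul_comm e₁ e₂ ▸ hb S hS hST)
    refine ⟨u + v, add_mem hu hv, ?_⟩
    rw [Subring.coe_add, Subring.coe_add, hux, hvy, mul_add]

theorem comap_mul_complement (hΘ : IsJaffardFamily Θ) {T : Subalgebra D K} (hT : T ∈ Θ)
    {I L : Ideal (intPoly T K)} {d : D} (hd : d ≠ 0) (hdI : constHom T K (algebraMap D T d) ∈ I)
    (hL : I * L = Ideal.span {constHom T K (algebraMap D T d)}) :
    I.comap (intInclusion T (hΘ.flat T hT)) * hΘ.toIsPreJaffardFamily.complement hT L d =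
      Ideal.span {constHom D K d} := by
  set J : Ideal (intPoly D K) := I.comap (intInclusion T (hΘ.flat T hT)) with hJ
  set J' : Ideal (intPoly D K) := hΘ.toIsPreJaffardFamily.complement hT L d
  apply le_antisymm
  · intro q hq
    apply hΘ.toIsPreJaffardFamily.mem_span_of_forall_mem hd
    intro S hS
    by_cases hST : S = T
    · subst hST
      have h1 := Ideal.mem_map_of_mem (intInclusion S (hΘ.flat S hS)) hq
      rw [Ideal.map_mul] at h1
      rw [← hL]
      refine Ideal.mul_mono Ideal.map_comap_le ?_ h1
      exact Ideal.map_le_iff_le_comap.mpr inf_le_left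
    · have hqJ' : q ∈ J' := Ideal.mul_le_right hq
      exact (IsPreJaffardFamily.mem_complement_iff.mp hqJ').2 S hS hST
  · rw [Ideal.span_singleton_le_iff_mem]
    have hdIL : constHom T K (algebraMap D T d) ∈ I * L := by
      rw [hL]
      exact Ideal.mem_span_singleton_self _
    -- The claim is applied to `d` itself, an element of `I L`. Splitting `1 = a + b` relative to `d
    -- e` then gives both `a ∈ d T` and `b ∈ e S` for `S ≠ T`.
    obtain ⟨e, he, hclaim⟩ := hΘ.exists_mem_mul_complement hT hd hdIL
    obtain ⟨a, b, hab, ha, hb⟩ := hΘ.exists_add_eq_one hT (mul_ne_zero hd he)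
    obtain ⟨y, hy, hyb⟩ := hclaim b fun S hS hST =>
      contraction_mul_le S e d (mul_comm d e ▸ hb S hS hST)
    have haJ : constHom D K a ∈ J := by
      obtain ⟨s, hs⟩ := Ideal.mem_span_singleton.mp (contraction_mul_le T d e ha)
      rw [hJ, Ideal.mem_comap, intInclusion_constHom, hs, map_mul]
      exact I.mul_mem_right _ hdI
    have hdJ' : constHom D K d ∈ J' := by
      exact IsPreJaffardFamily.mem_complement_iff.mpr
        ⟨Ideal.mul_le_right hdIL, fun S hS _ => Ideal.mem_span_singleton_self _⟩
    have hy' : y = constHom D K (b ^ 2 * d) := by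
      apply Subtype.ext
      rw [hyb, ← intInclusion_constHom T (hΘ.flat T hT), coe_intInclusion, coe_constHom,
        coe_constHom, ← Polynomial.C_pow, ← Polynomial.C_mul, ← map_pow, ← map_mul]
    -- Expansion of `d = (a + b)² d`: `a d` lies in the product as `a ∈ J`, `d ∈ J'`, and `b² d` is
    -- the element `y`.
    have hd' : d = (a + 2 * b) * (a * d) + b ^ 2 * d := by
      linear_combination (-d * (a + b + 1)) * hab
    have hsum : constHom D K d =
        constHom D K (a + 2 * b) * (constHom D K a * constHom D K d) + y := by
      rw [hy', ← map_mul, ← map_mul, ← map_add, ← hd']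
    rw [hsum]
    exact add_mem (Ideal.mul_mem_left _ _ (Ideal.mul_mem_mul haJ hdJ')) hy

/-- Classes of `Int(T)` lift to classes of `Int(D)` that become trivial at the other members of the
family. -/
theorem exists_picExt_eq (hΘ : IsJaffardFamily Θ) {T : Subalgebra D K} (hT : T ∈ Θ)
    (c : Pic (intPoly T K)) : ∃ c' : Pic (intPoly D K), picExt T (hΘ.flat T hT) c' = c ∧
      ∀ (T') (hT' : T' ∈ Θ), T' ≠ T → picExt T' (hΘ.flat T' hT') c' = 0 := by
  obtain ⟨I, hI, t, ht, htI⟩ := exists_represents_constHom_mem c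
  -- The numerator of `t` is a `T`-multiple of `t`, so the constant can be taken in `D`.
  obtain ⟨d, hd, hdI⟩ : ∃ d : D, d ≠ 0 ∧ constHom T K (algebraMap D T d) ∈ I := by
    obtain ⟨x, y, hy, hxy⟩ := IsFractionRing.div_surjective (A := D) (t : K)
    have hyK : algebraMap D K y ≠ 0 := IsFractionRing.to_map_ne_zero_of_mem_nonZeroDivisors hy
    have hx : algebraMap D T x = algebraMap D T y * t := by
      apply Subtype.ext
      change algebraMap D K x = algebraMap D K y * t
      rw [← hxy]
      field_simp
    have hyT : algebraMap D T y ≠ 0 := fun h0 => hyK (congrArg Subtype.val h0)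
    refine ⟨x, fun h0 => mul_ne_zero hyT ht ?_, ?_⟩
    · rw [← hx, h0, map_zero]
    · rw [hx, map_mul]
      exact I.mul_mem_left _ htI
  obtain ⟨L, hL⟩ := hI.exists_mul_eq_span hdI
  have hdK := constHom_ne_zero (K := K) hd
  have hdT : ∀ S : Subalgebra D K, constHom S K (algebraMap D S d) ≠ 0 := fun S => constHom_ne_zero
    ((map_ne_zero_iff _ (FaithfulSMul.algebraMap_injective D S)).mpr hd)
  set φ := intInclusion T (hΘ.flat T hT) with hφ
  set J : Ideal (intPoly D K) := I.comap φ with hJ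
  set J' : Ideal (intPoly D K) := hΘ.toIsPreJaffardFamily.complement hT L d
  have hJJ' : J * J' = Ideal.span {constHom D K d} := hΘ.comap_mul_complement hT hd hdI hL
  obtain ⟨c', hc'⟩ := exists_represents_of_mul_eq hdK hJJ'
  have hprod : ∀ (S) (hS : S ∈ Θ), J.map (intInclusion S (hΘ.flat S hS)) *
      J'.map (intInclusion S (hΘ.flat S hS)) = Ideal.span {constHom S K (algebraMap D S d)} := by
    intro S hS
    rw [← Ideal.map_mul, hJJ', Ideal.map_span, Set.image_singleton, intInclusion_constHom]
  refine ⟨c', ?_, fun S hS hST => ?_⟩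
  -- With extensions to `Int(T)` understood, `d I = J J' I ⊆ J L I = d J`, and `d` cancels.
  · have hmap : J.map φ = I := by
      refine le_antisymm Ideal.map_comap_le ?_
      rw [← Ideal.span_singleton_mul_right_mono (hdT T)]
      calc Ideal.span {constHom T K (algebraMap D T d)} * I
          = J.map φ * (J'.map φ * I) := by rw [← hprod T hT, mul_assoc]
        _ ≤ J.map φ * (L * I) := Ideal.mul_mono_right
          (Ideal.mul_mono_left (Ideal.map_le_iff_le_comap.mpr inf_le_left))
        _ = _ := by rw [mul_comm L, hL, mul_comm]
    have h1 := hc'.map_intInclusion T (hΘ.flat T hT)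
    rw [← hφ, hmap] at h1
    exact h1.eq hI
  · refine (hc'.map_intInclusion S (hΘ.flat S hS)).eq_zero_iff.mpr ⟨1, one_ne_zero, ?_⟩
    -- Over `Int(S)`, `J' ⊆ (d)` gives `(d) = J J' ⊆ d J`, and cancelling `d` makes `J` trivial.
    rw [Ideal.span_singleton_one, eq_top_iff, ← Ideal.span_singleton_mul_right_mono (hdT S),
      Ideal.mul_top]
    calc _ = _ := (hprod S hS).symm
      _ ≤ J.map (intInclusion S (hΘ.flat S hS)) *
          Ideal.span {constHom S K (algebraMap D S d)} := by
        refine Ideal.mul_mono_right (Ideal.map_le_iff_le_comap.mpr fun g hg => ?_)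
        exact (IsPreJaffardFamily.mem_complement_iff.mp hg).2 S hS hST
      _ = _ := mul_comm _ _

end IsJaffardFamily

end Extension

end IntPic

namespace IntPic

/-! ### Assembling the map to the direct sum. -/

section LocalClass

variable {D K : Type*} [CommRing D] [IsDomain D] [Field K] [Algebra D K] [IsFractionRing D K]

/-- The map `Pic(Int(D)) → PicPol(T)` that sends `[I]` to the class of `[I Int(T)]`. -/
noncomputable def localClass (T : Subalgebra D K) (hT : Module.Flat D T) :
    Pic (intPoly D K) →+ PicPol T K :=
  (QuotientAddGroup.mk' (picInt T K).range).comp (picExt T hT)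

theorem localClass_apply (T : Subalgebra D K) (hT : Module.Flat D T) (c : Pic (intPoly D K)) :
    localClass T hT c = QuotientAddGroup.mk (picExt T hT c) := rfl

theorem localClass_eq_zero_iff {T : Subalgebra D K} {hT : Module.Flat D T}
    {c : Pic (intPoly D K)} : localClass T hT c = 0 ↔ picExt T hT c ∈ (picInt T K).range :=
  QuotientAddGroup.eq_zero_iff _

theorem exists_directSum_of_finite {ι A : Type*} {β : ι → Type*} [AddCommGroup A]
    [∀ i, AddCommGroup (β i)] (f : ∀ i, A →+ β i) (hf : ∀ a, {i | f i a ≠ 0}.Finite) :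
    ∃ F : A →+ ⨁ i, β i, ∀ a i, F a i = f i a := by
  classical
  have h : ∀ a, ∃ y : ⨁ i, β i, ∀ i, y i = f i a := by
    intro a
    refine ⟨DFinsupp.mk (hf a).toFinset fun i => f i a, fun i => ?_⟩
    by_cases hi : f i a = 0
    · simp [DFinsupp.mk_apply, hi]
    · simp [DFinsupp.mk_apply, hi]
  choose F hF using h
  refine ⟨⟨⟨F, ?_⟩, ?_⟩, hF⟩
  · ext i
    rw [hF, map_zero, DirectSum.zero_apply]
  · intro a b
    ext i
    rw [DirectSum.add_apply, hF, hF, hF, map_add]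

theorem IsJaffardFamily.exists_localClass_hom {Θ : Set (Subalgebra D K)}
    (hΘ : IsJaffardFamily Θ) :
    ∃ π : Pic (intPoly D K) →+ ⨁ T : Θ, PicPol T.1 K,
      ∀ c (T : Θ), π c T = localClass T.1 (hΘ.flat T.1 T.2) c := by
  refine exists_directSum_of_finite (fun T : Θ => localClass T.1 (hΘ.flat T.1 T.2)) fun c => ?_
  refine (hΘ.finite_picExt_ne_zero c).subset fun T hT h0 => hT ?_
  rw [localClass_eq_zero_iff, h0]
  exact zero_mem _

theorem IsJaffardFamily.surjective_of_apply_eq {Θ : Set (Subalgebra D K)}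
    (hΘ : IsJaffardFamily Θ) {π : Pic (intPoly D K) →+ ⨁ T : Θ, PicPol T.1 K}
    (hπ : ∀ c (T : Θ), π c T = localClass T.1 (hΘ.flat T.1 T.2) c) : Function.Surjective π := by
  classical
  intro y
  change y ∈ Set.range π
  rw [← AddMonoidHom.coe_range, SetLike.mem_coe]
  induction y using DirectSum.induction_on with
  | zero => exact zero_mem _
  | add x y hx hy => exact add_mem hx hy
  | of T x =>
    obtain ⟨c, rfl⟩ := QuotientAddGroup.mk_surjective x
    obtain ⟨c', hc', hc0⟩ := hΘ.exists_picExt_eq T.2 c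
    refine ⟨c', ?_⟩
    ext S
    rw [hπ]
    by_cases hST : S = T
    · subst hST
      rw [DirectSum.of_eq_same, localClass_apply, hc']
    · rw [DirectSum.of_eq_of_ne _ _ _ hST, localClass_eq_zero_iff,
        hc0 S.1 S.2 fun h => hST (Subtype.ext h)]
      exact zero_mem _

end LocalClass

end IntPic

theorem mainTheorem1 {D K : Type*} [CommRing D] [IsDomain D] [Field K] [Algebra D K]
    [IsFractionRing D K] (Θ : Set (Subalgebra D K)) (hΘ : IntPic.IsJaffardFamily Θ) :
    ∃ π : IntPic.Pic (IntPic.intPoly D K) →+ ⨁ T : Θ, IntPic.PicPol T.1 K,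
      (∀ (x : IntPic.Pic (IntPic.intPoly D K)) (T : Θ),
        π x T = QuotientAddGroup.mk (IntPic.picExt T.1 (hΘ.flat T.1 T.2) x)) ∧
      Function.Injective (IntPic.picInt D K) ∧
      Function.Exact (IntPic.picInt D K) π ∧
      Function.Surjective π ∧
      ∃ e : IntPic.PicPol D K ≃+ ⨁ T : Θ, IntPic.PicPol T.1 K,
        ∀ x : IntPic.Pic (IntPic.intPoly D K), e (QuotientAddGroup.mk x) = π x := by
  obtain ⟨π, hπ⟩ := hΘ.exists_localClass_hom
  have hsurj := hΘ.surjective_of_apply_eq hπ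
  have hker : π.ker = (IntPic.picInt D K).range := by
    ext c
    rw [AddMonoidHom.mem_ker]
    constructor
    · intro hc
      refine hΘ.toIsPreJaffardFamily.mem_range_picInt fun T hT => ?_
      rw [← IntPic.localClass_eq_zero_iff, ← hπ c ⟨T, hT⟩, hc, DirectSum.zero_apply]
    · rintro ⟨c₀, rfl⟩
      ext T
      rw [hπ, DirectSum.zero_apply, IntPic.localClass_eq_zero_iff]
      exact IntPic.picExt_picInt _ _ _
  refine ⟨π, hπ, IntPic.picInt_injective D K, AddMonoidHom.exact_iff.mpr hker, hsurj,
    (QuotientAddGroup.quotientAddEquivOfEq hker.symm).trans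
      (QuotientAddGroup.quotientKerEquivOfSurjective π hsurj), fun x => rfl⟩
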